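/- For $\underline{\mathbf Y}\in\mathbb R^{I\times J\times K}$ let $\mathrm{rank}_\circ(\underline{\mathbf Y})$ be the least $R\ge 0$ such that $\underline{\mathbf Y}=\sum_{r=1}^R \mathbf x_r\circ\mathbf y_r\circ\mathbf z_r$ for some vectors $\mathbf x_r\in\mathbb R^I$, $\mathbf y_r\in\mathbb R^J$, $\mathbf z_r\in\mathbb R^K$, where $(\mathbf x\circ\mathbf y\circ\mathbf z)_{ijk}=x_iy_jz_k$. Let $\mathcal S_R(I,J,2)=\{\underline{\mathbf Y}\in\mathbb R^{I\times J\times 2} : \mathrm{rank}_\circ(\underline{\mathbf Y})\le R\}$ and let $\overline{\mathcal S}_R(I,J,2)$ be its closure in $\mathbb R^{I\times J\times 2}$ (with respect to the Frobenius norm). Let $\mathcal P_R(I,J,2)$ be the set of arrays $\underline{\mathbf Y}\in\mathbb R^{I\times J\times 2}$ with a full $R$-term Generalized Schur Decomposition, that is, whose two frontal slices $\mathbf Y_1,\mathbf Y_2\in\mathbb R^{I\times J}$ can be written as $$\mathbf Y_k=\mathbf Q_a\,\mathbf R_k\,\mathbf Q_b^T,\qquad k=1,2,$$ with real matrices $\mathbf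 Q_a$ ($I\times R$) and $\mathbf Q_b$ ($J\times R$) satisfying $\mathbf Q_a^T\mathbf Q_a=\mathbf Q_b^T\mathbf Q_b=\mathbf I_R$ and real upper triangular $R\times R$ matrices $\mathbf R_1,\mathbf R_2$ (not required to be nonsingular). Theorem. If $R\le\min(I,J)$, then $\mathcal P_R(I,J,2)=\overline{\mathcal S}_R(I,J,2)$. -/

import Mathlib

namespace GSD

/-- Real `I × J × K` arrays. The topology is the product topology, which is the topology of the
Frobenius norm since the space is finite-dimensional. -/
abbrev RealArray (I J K : ℕ) : Type := Fin I → Fin J → Fin K → ℝ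

/-- The outer product `x ∘ y ∘ z` of three vectors. -/
def outer {I J K : ℕ} (x : Fin I → ℝ) (y : Fin J → ℝ) (z : Fin K → ℝ) : RealArray I J K :=
  fun i j k => x i * y j * z k

/-- `Y` is a sum of `R` outer products of vectors. -/
def IsSumOfOuter {I J K : ℕ} (Y : RealArray I J K) (R : ℕ) : Prop :=
  ∃ (x : Fin R → Fin I → ℝ) (y : Fin R → Fin J → ℝ) (z : Fin R → Fin K → ℝ),
    Y = ∑ r, outer (x r) (y r) (z r)

/-- Every array is a finite sum of outer products, so the minimum defining the rank is attained. -/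
theorem exists_isSumOfOuter {I J K : ℕ} (Y : RealArray I J K) : ∃ R : ℕ, IsSumOfOuter Y R := by
  let e := Fintype.equivFin (Fin I × Fin J × Fin K)
  refine ⟨_, fun r => Pi.single (e.symm r).1 1, fun r => Pi.single (e.symm r).2.1 1,
    fun r => Pi.single (e.symm r).2.2 (Y (e.symm r).1 (e.symm r).2.1 (e.symm r).2.2), ?_⟩
  rw [Equiv.sum_comp e.symm (fun p : Fin I × Fin J × Fin K =>
    outer (Pi.single p.1 (1 : ℝ)) (Pi.single p.2.1 (1 : ℝ))
      (Pi.single p.2.2 (Y p.1 p.2.1 p.2.2)))]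
  funext i j k
  simp [outer, Fintype.sum_prod_type, Finset.sum_apply, Pi.single_apply]

open Classical in
/-- The outer-product rank of `Y`: the least `R` such that `Y` is a sum of `R` outer products. -/
noncomputable def outerRank {I J K : ℕ} (Y : RealArray I J K) : ℕ :=
  Nat.find (exists_isSumOfOuter Y)

/-- The set `S_R(I,J,K)` of arrays of outer-product rank at most `R`. -/
def rankSet (R I J K : ℕ) : Set (RealArray I J K) :=
  {Y | outerRank Y ≤ R}

/-- The `k`-th frontal slice of an array, an `I × J` matrix. -/
def slice {I J K : ℕ} (Y : RealArray I J K) (k : Fin K) : Matrix (Fin I) (Fin J) ℝ :=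
  Matrix.of fun i j => Y i j k

/-- The set `P_R(I,J,2)` of arrays with a full `R`-term Generalized Schur Decomposition:
`Y_k = Q_a R_k Q_bᵀ` for both slices, with `Q_a`, `Q_b` column-orthonormal (common to both slices)
and each `R_k` an `R × R` upper triangular matrix. -/
def gsdSet (R I J : ℕ) : Set (RealArray I J 2) :=
  {Y | ∃ (Qa : Matrix (Fin I) (Fin R) ℝ) (Qb : Matrix (Fin J) (Fin R) ℝ)
      (T : Fin 2 → Matrix (Fin R) (Fin R) ℝ),
    Qa.transpose * Qa = 1 ∧ Qb.transpose * Qb = 1 ∧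
    (∀ k : Fin 2, ∀ i j : Fin R, j < i → T k i j = 0) ∧
    ∀ k : Fin 2, slice Y k = Qa * T k * Qb.transpose}

end GSD

/-!
For `k = 0, 1`, a sum of `R` outer products has slices `Y_k = A * D_k * Bᵀ` with `D_k` diagonal.

* *Low rank implies a Schur decomposition.* As `R ≤ min I J`, write `A = Q_a * U` with `U` upper
  triangular and `B = Q_b * L` with `L` lower triangular (`exists_qr`, `exists_ql`); then
  `U * D_k * Lᵀ` is upper triangular. The Schur set is moreover closed (`isClosed_gsdSet`): the
  matrices with orthonormal columns form a compact set, and for fixed `Q_a`, `Q_b` the triangular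
  factor can only be `Q_aᵀ * Y_k * Q_b`, so the decompositions form a closed set, which is projected
  along a compact factor.
* *A Schur decomposition implies being a limit of low-rank arrays.* For triangular `T₀`, `T₁` with
  `T₀` nonsingular and pairwise distinct ratios of diagonal entries, the pencil `T₁ - μ T₀` has `R`
  independent generalized eigenvectors, which diagonalizes both matrices simultaneously
  (`exists_simultaneous_factorization`). Adding `ε` to the diagonal of `T₀` and `ε * r` to the
  `r`-th diagonal entry of `T₁` achieves this for all small `ε ≠ 0`.
-/

open Matrix Filter Topology

namespace GSD

/-! ### Arrays of bounded rank -/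

lemma IsSumOfOuter.mono {I J K : ℕ} {Y : RealArray I J K} {R S : ℕ} (h : IsSumOfOuter Y R)
    (hRS : R ≤ S) : IsSumOfOuter Y S := by
  obtain ⟨x, y, z, rfl⟩ := h
  obtain ⟨d, rfl⟩ := Nat.exists_eq_add_of_le hRS
  refine ⟨Fin.append x 0, Fin.append y 0, Fin.append z 0, ?_⟩
  rw [Fin.sum_univ_add]
  have h0 : outer (0 : Fin I → ℝ) (0 : Fin J → ℝ) (0 : Fin K → ℝ) = 0 := by
    funext i j k; simp [outer]
  simp [h0]

lemma mem_rankSet_iff {I J K R : ℕ} {Y : RealArray I J K} :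
    Y ∈ rankSet R I J K ↔ IsSumOfOuter Y R := by
  classical
  constructor
  · intro h
    exact (Nat.find_spec (exists_isSumOfOuter Y)).mono h
  · intro h
    exact Nat.find_min' (exists_isSumOfOuter Y) h

/-- Slice form of a sum of outer products: all slices share the outer factors, and the middle
factors are diagonal. -/
lemma isSumOfOuter_iff_slice {I J K R : ℕ} {Y : RealArray I J K} :
    IsSumOfOuter Y R ↔ ∃ (A : Matrix (Fin I) (Fin R) ℝ) (B : Matrix (Fin J) (Fin R) ℝ)
      (d : Fin K → Fin R → ℝ), ∀ k, slice Y k = A * diagonal (d k) * Bᵀ := by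
  constructor
  · rintro ⟨x, y, z, rfl⟩
    refine ⟨(of x)ᵀ, (of y)ᵀ, fun k r => z r k, fun k => ?_⟩
    ext i j
    simp only [slice, of_apply, Finset.sum_apply, outer, mul_apply (M := _ * _), mul_diagonal,
      transpose_apply]
    exact Finset.sum_congr rfl fun r _ => by ring
  · rintro ⟨A, B, d, h⟩
    refine ⟨fun r i => A i r, fun r j => B j r, fun r k => d k r, ?_⟩
    funext i j k
    have hk := congrFun (congrFun (h k) i) j
    simp only [slice, of_apply, mul_apply (M := _ * _), mul_diagonal, transpose_apply] at hk
    simp only [hk, Finset.sum_apply, outer]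
    exact Finset.sum_congr rfl fun r _ => by ring

/-! ### Orthogonal-triangular factorizations -/

/-- Thin QR factorization of a matrix of arbitrary rank. Padding with zero columns to a square
matrix lets Gram–Schmidt supply the orthonormal columns that `A` itself does not determine. -/
lemma exists_qr {m n : ℕ} (hnm : n ≤ m) (A : Matrix (Fin m) (Fin n) ℝ) :
    ∃ (Q : Matrix (Fin m) (Fin n) ℝ) (U : Matrix (Fin n) (Fin n) ℝ),
      Qᵀ * Q = 1 ∧ (∀ i j, j < i → U i j = 0) ∧ A = Q * U := by
  let f : Fin m → EuclideanSpace ℝ (Fin m) := fun i =>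
    if h : (i : ℕ) < n then WithLp.toLp 2 fun l => A l ⟨i, h⟩ else 0
  have hcard : Module.finrank ℝ (EuclideanSpace ℝ (Fin m)) = Fintype.card (Fin m) := by simp
  let b := InnerProductSpace.gramSchmidtOrthonormalBasis hcard f
  have htri : ∀ {i j : Fin m}, i < j → inner ℝ (b j) (f i) = 0 := fun hij =>
    InnerProductSpace.gramSchmidtOrthonormalBasis_inv_triangular hcard f hij
  have hf : ∀ j l, f (Fin.castLE hnm j) l = A l j := by
    intro j l
    have : f (Fin.castLE hnm j) = WithLp.toLp 2 fun l => A l j := dif_pos j.2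
    rw [this]
  refine ⟨of fun l r => b (Fin.castLE hnm r) l,
    of fun r j => inner ℝ (b (Fin.castLE hnm r)) (f (Fin.castLE hnm j)), ?_, ?_, ?_⟩
  · ext i j
    have := orthonormal_iff_ite.1 b.orthonormal (Fin.castLE hnm i) (Fin.castLE hnm j)
    simp only [PiLp.inner_apply, (Fin.castLE_injective hnm).eq_iff] at this
    rw [one_apply, ← this, mul_apply]
    exact Finset.sum_congr rfl fun l _ => mul_comm _ _
  · intro i j hij
    exact htri (i := Fin.castLE hnm j) (j := Fin.castLE hnm i) hij
  · ext l j
    have h1 := congrArg (fun v : EuclideanSpace ℝ (Fin m) => v l)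
      (b.sum_repr' (f (Fin.castLE hnm j)))
    simp only [hf, WithLp.ofLp_sum, WithLp.ofLp_smul, Finset.sum_apply, Pi.smul_apply,
      smul_eq_mul] at h1
    rw [← h1, mul_apply]
    symm
    refine Fintype.sum_of_injective (Fin.castLE hnm) (Fin.castLE_injective hnm) _ _ ?_ ?_
    · intro i hi
      have hni : n ≤ (i : ℕ) := by
        by_contra hlt
        exact hi ⟨⟨i, not_le.1 hlt⟩, rfl⟩
      rw [htri (by rw [Fin.lt_def]; exact lt_of_lt_of_le j.2 hni), zero_mul]
    · intro r
      simp [mul_comm]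

/-- Thin QL factorization, obtained from QR by reversing the order of the columns. -/
lemma exists_ql {m n : ℕ} (hnm : n ≤ m) (A : Matrix (Fin m) (Fin n) ℝ) :
    ∃ (Q : Matrix (Fin m) (Fin n) ℝ) (L : Matrix (Fin n) (Fin n) ℝ),
      Qᵀ * Q = 1 ∧ (∀ i j, i < j → L i j = 0) ∧ A = Q * L := by
  obtain ⟨Q, U, hQ, hU, hA⟩ := exists_qr hnm (A.submatrix id Fin.revPerm)
  refine ⟨Q.submatrix id Fin.revPerm, U.submatrix Fin.revPerm Fin.revPerm, ?_, ?_, ?_⟩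
  · rw [transpose_submatrix, ← submatrix_mul _ _ _ _ _ Function.bijective_id, hQ,
      submatrix_one_equiv]
  · intro i j hij
    exact hU _ _ (by simpa using hij)
  · rw [submatrix_mul_equiv, ← hA]
    ext i j
    simp

lemma rankSet_subset_gsdSet {I J R : ℕ} (hR : R ≤ min I J) :
    rankSet R I J 2 ⊆ gsdSet R I J := by
  intro Y hY
  obtain ⟨A, B, d, h⟩ := isSumOfOuter_iff_slice.1 (mem_rankSet_iff.1 hY)
  obtain ⟨Qa, U, hQa, hU, rfl⟩ := exists_qr (hR.trans (min_le_left _ _)) A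
  obtain ⟨Qb, L, hQb, hL, rfl⟩ := exists_ql (hR.trans (min_le_right _ _)) B
  refine ⟨Qa, Qb, fun k => U * diagonal (d k) * Lᵀ, hQa, hQb, ?_, fun k => ?_⟩
  · intro k i j hij
    change (U * diagonal (d k) * Lᵀ) i j = 0
    rw [mul_apply]
    refine Finset.sum_eq_zero fun l _ => ?_
    rw [mul_diagonal, transpose_apply]
    rcases lt_or_ge l i with hl | hl
    · rw [hU i l hl, zero_mul, zero_mul]
    · rw [hL j l (hij.trans_le hl), mul_zero]
  · rw [h k, transpose_mul]
    simp only [Matrix.mul_assoc]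

/-! ### Closedness of the set of Schur-decomposable arrays -/

/-- The Stiefel manifold: real `m × n` matrices with orthonormal columns. -/
def stiefel (m n : ℕ) : Set (Matrix (Fin m) (Fin n) ℝ) := {Q | Qᵀ * Q = 1}

lemma isCompact_stiefel (m n : ℕ) : IsCompact (stiefel m n) := by
  have hbox : IsCompact (Set.pi Set.univ fun _ : Fin m =>
      Set.pi Set.univ fun _ : Fin n => Set.Icc (-1 : ℝ) 1) :=
    isCompact_univ_pi fun _ => isCompact_univ_pi fun _ => isCompact_Icc
  refine hbox.of_isClosed_subset ?_ ?_
  · have hc : Continuous fun Q : Matrix (Fin m) (Fin n) ℝ => Qᵀ * Q := by fun_prop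
    exact isClosed_eq hc continuous_const
  · intro (Q : Matrix (Fin m) (Fin n) ℝ) hQ i _ j _
    have h1 : ∑ l, Q l j * Q l j = 1 := by
      have := congrFun (congrFun (show Qᵀ * Q = 1 from hQ) j) j
      simpa [mul_apply] using this
    have h2 : Q i j * Q i j ≤ 1 := by
      rw [← h1]
      exact Finset.single_le_sum (f := fun l => Q l j * Q l j)
        (fun l _ => mul_self_nonneg _) (Finset.mem_univ i)
    exact abs_le.1 (abs_le_one_iff_mul_self_le_one.2 h2)

lemma continuous_slice {I J K : ℕ} (k : Fin K) :
    Continuous fun Y : RealArray I J K => slice Y k :=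
  continuous_matrix fun i j => by
    simp only [slice, of_apply]
    fun_prop

lemma isClosed_gsdSet (R I J : ℕ) : IsClosed (gsdSet R I J) := by
  have := isCompact_iff_compactSpace.1 (isCompact_stiefel I R)
  have := isCompact_iff_compactSpace.1 (isCompact_stiefel J R)
  let M : (stiefel I R × stiefel J R) × RealArray I J 2 → Fin 2 → Matrix (Fin R) (Fin R) ℝ :=
    fun p k => (p.1.1 : Matrix (Fin I) (Fin R) ℝ)ᵀ * slice p.2 k * (p.1.2 : Matrix (Fin J) (Fin R) ℝ)
  let C : Set ((stiefel I R × stiefel J R) × RealArray I J 2) :=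
    {p | (∀ k i j, j < i → M p k i j = 0) ∧
      ∀ k, slice p.2 k = (p.1.1 : Matrix (Fin I) (Fin R) ℝ) * M p k * (p.1.2 : Matrix (Fin J) (Fin R) ℝ)ᵀ}
  have hs : ∀ k, Continuous fun p : (stiefel I R × stiefel J R) × RealArray I J 2 =>
      slice p.2 k := fun k => (continuous_slice k).comp continuous_snd
  have ha : Continuous fun p : (stiefel I R × stiefel J R) × RealArray I J 2 =>
      (p.1.1 : Matrix (Fin I) (Fin R) ℝ) := by fun_prop
  have hb : Continuous fun p : (stiefel I R × stiefel J R) × RealArray I J 2 =>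
      (p.1.2 : Matrix (Fin J) (Fin R) ℝ) := by fun_prop
  have hM : ∀ k, Continuous fun p => M p k := fun k =>
    (ha.matrix_transpose.matrix_mul (hs k)).matrix_mul hb
  have hC₁ : IsClosed {p | ∀ k i j, j < i → M p k i j = 0} := by
    simp only [Set.ofPred_forall]
    exact isClosed_iInter fun k => isClosed_iInter fun i => isClosed_iInter fun j =>
      isClosed_iInter fun _ => isClosed_eq ((hM k).matrix_elem i j) continuous_const
  have hC₂ : IsClosed {p : (stiefel I R × stiefel J R) × RealArray I J 2 | ∀ k, slice p.2 k =
      (p.1.1 : Matrix (Fin I) (Fin R) ℝ) * M p k * (p.1.2 : Matrix (Fin J) (Fin R) ℝ)ᵀ} := by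
    simp only [Set.ofPred_forall]
    exact isClosed_iInter fun k =>
      isClosed_eq (hs k) ((ha.matrix_mul (hM k)).matrix_mul hb.matrix_transpose)
  have hC : IsClosed C := hC₁.inter hC₂
  have himage : gsdSet R I J = Prod.snd '' C := by
    ext Y
    constructor
    · rintro ⟨Qa, Qb, T, hQa, hQb, hT, hY⟩
      have hMT : ∀ k, M ((⟨Qa, hQa⟩, ⟨Qb, hQb⟩), Y) k = T k := by
        intro k
        calc Qaᵀ * slice Y k * Qb = (Qaᵀ * Qa) * T k * (Qbᵀ * Qb) := by
              rw [hY k]; simp only [Matrix.mul_assoc]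
          _ = T k := by rw [hQa, hQb, Matrix.one_mul, Matrix.mul_one]
      refine ⟨((⟨Qa, hQa⟩, ⟨Qb, hQb⟩), Y), ⟨fun k i j hij => ?_, fun k => ?_⟩, rfl⟩
      · rw [hMT]; exact hT k i j hij
      · rw [hMT]; exact hY k
    · rintro ⟨⟨⟨⟨Qa, hQa⟩, ⟨Qb, hQb⟩⟩, Y⟩, ⟨h1, h2⟩, rfl⟩
      exact ⟨Qa, Qb, _, hQa, hQb, h1, h2⟩
  rw [himage]
  exact isClosedMap_snd_of_compactSpace C hC

/-! ### Generic triangular pencils -/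

/-- A triangular pencil with nonsingular `T₀` and pairwise distinct diagonal ratios is
simultaneously diagonalized by its generalized eigenvectors. -/
lemma exists_simultaneous_factorization {n : ℕ} (T₀ T₁ : Matrix (Fin n) (Fin n) ℝ)
    (h₀ : ∀ i j, j < i → T₀ i j = 0) (h₁ : ∀ i j, j < i → T₁ i j = 0)
    (hne : ∀ i, T₀ i i ≠ 0) (hinj : Function.Injective fun i => T₁ i i / T₀ i i) :
    ∃ (A B : Matrix (Fin n) (Fin n) ℝ) (d : Fin n → ℝ),
      T₀ = A * B ∧ T₁ = A * diagonal d * B := by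
  set μ : Fin n → ℝ := fun i => T₁ i i / T₀ i i with hμ
  have hv : ∀ r, ∃ v, v ≠ 0 ∧ (T₁ - μ r • T₀) *ᵥ v = 0 := by
    intro r
    refine exists_mulVec_eq_zero_iff.2 ?_
    rw [det_of_isUpperTriangular]
    · refine Finset.prod_eq_zero (Finset.mem_univ r) ?_
      simp [hμ, div_mul_cancel₀ _ (hne r)]
    · intro i j hij
      have hij' : j < i := hij
      simp [h₀ i j hij', h₁ i j hij']
  choose v hv0 hv using hv
  have hdet₀ : IsUnit T₀.det := by
    rw [det_of_isUpperTriangular (fun i j hij => h₀ i j hij), isUnit_iff_ne_zero]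
    exact Finset.prod_ne_zero_iff.2 fun i _ => hne i
  have heig : ∀ r, T₁ *ᵥ v r = μ r • T₀ *ᵥ v r := by
    intro r
    have := hv r
    rwa [sub_mulVec, smul_mulVec, sub_eq_zero] at this
  have hli : LinearIndependent ℝ v := by
    refine Module.End.eigenvectors_linearIndependent' (toLin' (T₀⁻¹ * T₁)) μ hinj v fun r => ?_
    refine ⟨Module.End.mem_eigenspace_iff.2 ?_, hv0 r⟩
    rw [toLin'_apply, ← mulVec_mulVec, heig, mulVec_smul, mulVec_mulVec,
      nonsing_inv_mul _ hdet₀, one_mulVec]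
  let V : Matrix (Fin n) (Fin n) ℝ := (of v)ᵀ
  have hV : IsUnit V.det := by
    rw [← isUnit_iff_isUnit_det, ← linearIndependent_cols_iff_isUnit]
    exact hli
  have hTV : T₁ * V = T₀ * V * diagonal μ := by
    ext i r
    have := congrFun (heig r) i
    rw [mul_diagonal, mul_apply, mul_apply, mul_comm]
    exact this
  refine ⟨T₀ * V, V⁻¹, μ, ?_, ?_⟩
  · rw [Matrix.mul_assoc, mul_nonsing_inv _ hV, Matrix.mul_one]
  · rw [← hTV, Matrix.mul_assoc, mul_nonsing_inv _ hV, Matrix.mul_one]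

lemma eventually_nhdsNE_eval_ne_zero {p : Polynomial ℝ} (hp : p ≠ 0) (a : ℝ) :
    ∀ᶠ x in 𝓝[≠] a, p.eval x ≠ 0 := by
  have hfin : {x | p.IsRoot x}.Finite := Polynomial.finite_setOfPred_isRoot hp
  exact nhdsNE_le_cofinite a hfin.compl_mem_cofinite

/-- The diagonal perturbation `(ε, ε * r)` separates the ratios: cross-multiplying, a coincidence of
the ratios of two distinct rows is a root of a quadratic whose leading coefficient is the
difference of the row indices. -/
lemma eventually_generic {n : ℕ} (a b : Fin n → ℝ) :
    ∀ᶠ ε in 𝓝[≠] (0 : ℝ), (∀ i, a i + ε ≠ 0) ∧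
      Function.Injective fun i => (b i + ε * (i : ℕ)) / (a i + ε) := by
  open Polynomial in
  have h1 : ∀ᶠ ε in 𝓝[≠] (0 : ℝ), ∀ i, a i + ε ≠ 0 := by
    refine eventually_all.2 fun i => ?_
    have hp : (X + C (a i)) ≠ 0 := X_add_C_ne_zero _
    simpa [add_comm] using eventually_nhdsNE_eval_ne_zero hp 0
  open Polynomial in
  have h2 : ∀ᶠ ε in 𝓝[≠] (0 : ℝ), ∀ i j : Fin n, i ≠ j →
      (b i + ε * (i : ℕ)) * (a j + ε) - (b j + ε * (j : ℕ)) * (a i + ε) ≠ 0 := by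
    refine eventually_all.2 fun i => eventually_all.2 fun j => eventually_all.2 fun hij => ?_
    let p : ℝ[X] := C (((i : ℕ) : ℝ) - (j : ℕ)) * X ^ 2 +
      C (b i + (i : ℕ) * a j - b j - (j : ℕ) * a i) * X + C (b i * a j - b j * a i)
    have hlead : ((i : ℕ) : ℝ) - (j : ℕ) ≠ 0 := by
      rw [sub_ne_zero, Nat.cast_injective.ne_iff]
      exact fun h => hij (Fin.ext h)
    have hp : p ≠ 0 := by
      intro h
      have := natDegree_quadratic (b := b i + (i : ℕ) * a j - b j - (j : ℕ) * a i)
        (c := b i * a j - b j * a i) hlead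
      change p.natDegree = 2 at this
      simp [h] at this
    filter_upwards [eventually_nhdsNE_eval_ne_zero hp 0] with ε hε
    convert hε using 1
    simp only [p, eval_add, eval_mul, eval_C, eval_pow, eval_X]
    ring
  filter_upwards [h1, h2] with ε hε1 hε2
  refine ⟨hε1, fun i j hij => ?_⟩
  by_contra hne
  exact hε2 i j hne (sub_eq_zero.2 ((div_eq_div_iff (hε1 i) (hε1 j)).1 hij))

lemma gsdSet_subset_closure (R I J : ℕ) : gsdSet R I J ⊆ closure (rankSet R I J 2) := by
  rintro Y ⟨Qa, Qb, T, -, -, hT, hY⟩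
  -- the `r`-th diagonal entry of the direction of perturbation of the slice `k`
  let w : Fin 2 → Fin R → ℝ := ![fun _ => 1, fun r => (r : ℕ)]
  let S : ℝ → Fin 2 → Matrix (Fin R) (Fin R) ℝ := fun ε k => T k + ε • diagonal (w k)
  let Z : ℝ → RealArray I J 2 := fun ε i j k => (Qa * S ε k * Qbᵀ) i j
  have hZcont : Continuous Z := by
    have hS : ∀ k, Continuous fun ε => Qa * S ε k * Qbᵀ := by
      intro k
      simp only [S]
      fun_prop
    exact continuous_pi fun i => continuous_pi fun j => continuous_pi fun k =>
      (hS k).matrix_elem i j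
  have hZ0 : Z 0 = Y := by
    funext i j k
    have := congrFun (congrFun (hY k) i) j
    simp only [Z, S, zero_smul, add_zero]
    exact this.symm
  have hlim : Tendsto Z (𝓝[≠] 0) (𝓝 Y) := by
    rw [← hZ0]
    exact hZcont.continuousAt.tendsto.mono_left nhdsWithin_le_nhds
  refine mem_closure_of_tendsto hlim ?_
  filter_upwards [eventually_generic (fun r => T 0 r r) (fun r => T 1 r r)] with ε ⟨hne, hinj⟩
  have hS : ∀ k i j, j < i → S ε k i j = 0 := by
    intro k i j hij
    simp [S, hT k i j hij, diagonal_apply_ne _ hij.ne']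
  obtain ⟨A, B, d, h0, h1⟩ := exists_simultaneous_factorization (S ε 0) (S ε 1) (hS 0) (hS 1)
    (by simpa [S, w] using hne) (by simpa [S, w] using hinj)
  refine mem_rankSet_iff.2 (isSumOfOuter_iff_slice.2
    ⟨Qa * A, Qb * Bᵀ, ![fun _ => 1, d], fun k => ?_⟩)
  change Qa * S ε k * Qbᵀ = _
  fin_cases k
  · simp [h0, transpose_mul, Matrix.mul_assoc]
  · simp [h1, transpose_mul, Matrix.mul_assoc]

end GSD

theorem theorem2 (I J R : ℕ) (hR : R ≤ min I J) :
    GSD.gsdSet R I J = closure (GSD.rankSet R I J 2) :=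
  (GSD.gsdSet_subset_closure R I J).antisymm
    (closure_minimal (GSD.rankSet_subset_gsdSet hR) (GSD.isClosed_gsdSet R I J))
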